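/- Consider the mobile layer (ML) of a two-layer spatial-modulation-aided layered-division-multiplexing (SM-LDM) downlink with $N_t\ge 1$ transmit antennas and $N_r$ receive antennas at the mobile receiver, transmit powers $\rho_{ml}>\rho_{fl}>0$ of the mobile and the fixed layer, and noise variance $\sigma^2>0$. The channel matrix $\mathbf H=[\mathbf h_1,\dots,\mathbf h_{N_t}]\in\mathbb C^{N_r\times N_t}$ has i.i.d. $\mathcal{CN}(0,1)$ entries. Let $\mathbf g_n=\mathbf g_n(\mathbf H)\in\mathbb C^{N_r}$, $1\le n\le N_t$, be arbitrary linear combining vectors such that all entries of $\mathbf g_n$ and all gains $\mathbf g_n^H\mathbf h_k$ are square-integrable and $E\{\mathbf g_n^H\mathbf h_n\}\neq 0$. Put $$\mathrm{SINR}_n=\frac{\frac{\rho_{ml}}{N_t}\left|E\{\mathbf g_n^H\mathbf h_n\}\right|^2}{\sum_{k=1}^{N_t}\frac{\rho_{ml}}{N_t}E\{|\mathbf g_n^H\mathbf h_k|^2\}-\frac{\rho_{ml}}{N_t}\left|E\{\mathbf g_n^H\mathbf h_n\}\right|^2+\sum_{m=1}^{N_t}\frac{\rho_{fl}}{N_t}E\{|\mathbf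 g_n^H\mathbf h_m|^2\}+\sigma^2E\{\|\mathbf g_n\|^2\}}.$$ The spectral efficiency of ML with this linear combining is the mutual information $I(\hat{\mathbf y};\mathbf x)$, in bits, of the equivalent additive-noise channel $\hat{\mathbf y}=\mathbf x+\mathbf w$, where $\mathbf x=\sqrt{N_t}\,s\,\mathbf e_a$ is the spatial modulation symbol normalized to unit average power per antenna, $s\sim\mathcal{CN}(0,1)$ is the constellation symbol, the active antenna $a$ is uniform on $\{1,\dots,N_t\}$, $\mathbf e_a$ is the $a$-th standard basis vector, $\mathbf w\sim\mathcal{CN}\big(\mathbf 0,\mathrm{diag}\{1/\mathrm{SINR}_1,\dots,1/\mathrm{SINR}_{N_t}\}\big)$, and $s,a,\mathbf w$ are independent. Then $I(\hat{\mathbf y};\mathbf x)$ is finite and $$I(\hat{\mathbf y};\mathbf x)\ \ge\ \log_2 N_t-N_t+\frac1{N_t}\left\{\sum_{n=1}^{N_t}\log_2\left(1+N_t\,\mathrm{SINR}_n\right)-\sum_{n=1}^{N_t}\log_2\left[\sum_{k=1}^{N_t}\frac{\det\mathbf\Sigma_n}{\det(\mathbf\Sigma_n+\mathbf\Sigma_k)}\right]\right\},$$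 where $\mathbf\Sigma_n=\mathrm{diag}\{1/\mathrm{SINR}_1,\dots,1/\mathrm{SINR}_{N_t}\}+N_t\,\mathrm{diag}\{\mathbf e_n\}$. -/

import Mathlib

open MeasureTheory ProbabilityTheory
open scoped ENNReal NNReal

noncomputable section

namespace SMLDM

/-- The circularly symmetric complex Gaussian distribution `CN(0, v)` on `ℂ`: the real and the
imaginary part are independent real Gaussians with mean `0` and variance `v / 2`. -/
def complexGaussian (v : ℝ) : Measure ℂ :=
  ((gaussianReal 0 (v / 2).toNNReal).prod (gaussianReal 0 (v / 2).toNNReal)).map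
    (fun p : ℝ × ℝ => (p.1 : ℂ) + (p.2 : ℂ) * Complex.I)

/-- The distribution `CN(0, diag d)` on `ℂ^N` (the coordinates are independent). -/
def complexGaussianDiag {N : ℕ} (d : Fin N → ℝ) : Measure (Fin N → ℂ) :=
  Measure.pi (fun i => complexGaussian (d i))

/-- Realizations of the `Nr × Nt` channel matrix, stored by columns: `H n` is the column `h_n`
belonging to the `n`-th transmit antenna. -/
abbrev Channel (Nt Nr : ℕ) : Type := Fin Nt → Fin Nr → ℂ

/-- The law of the Rayleigh fading channel: all entries are i.i.d. `CN(0, 1)`. -/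
def rayleigh (Nt Nr : ℕ) : Measure (Channel Nt Nr) :=
  Measure.pi (fun _ => Measure.pi (fun _ => complexGaussian 1))

variable {Nt Nr : ℕ}

/-- The gain `g_n^H h_k` for the channel realization `H`, where the combining vector `g_n = g n H`
of the `n`-th transmit antenna depends on the channel realization. -/
def gain (g : Fin Nt → Channel Nt Nr → Fin Nr → ℂ) (n k : Fin Nt) (H : Channel Nt Nr) : ℂ :=
  ∑ r, star (g n H r) * H k r

/-- The SINR of the mobile layer for the `n`-th transmit antenna. -/
def sinr (ρml ρfl σsq : ℝ) (g : Fin Nt → Channel Nt Nr → Fin Nr → ℂ) (n : Fin Nt) : ℝ :=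
  (ρml / Nt * ‖∫ H, gain g n n H ∂(rayleigh Nt Nr)‖ ^ 2) /
    ((∑ k, ρml / Nt * ∫ H, ‖gain g n k H‖ ^ 2 ∂(rayleigh Nt Nr))
      - ρml / Nt * ‖∫ H, gain g n n H ∂(rayleigh Nt Nr)‖ ^ 2
      + (∑ m, ρfl / Nt * ∫ H, ‖gain g n m H‖ ^ 2 ∂(rayleigh Nt Nr))
      + σsq * ∫ H, ∑ r, ‖g n H r‖ ^ 2 ∂(rayleigh Nt Nr))

/-- The diagonal covariance matrix `Σ_n = diag(1 / SINR_1, …, 1 / SINR_Nt) + Nt diag(e_n)`. -/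
def covMatrix (S : Fin Nt → ℝ) (n : Fin Nt) : Matrix (Fin Nt) (Fin Nt) ℝ :=
  Matrix.diagonal (fun i => 1 / S i) + (Nt : ℝ) • Matrix.diagonal (Pi.single n 1)

/-- The closed-form lower bound on the spectral efficiency, in bits. -/
def seBound (S : Fin Nt → ℝ) : ℝ :=
  Real.logb 2 Nt - Nt + 1 / Nt *
    ((∑ n, Real.logb 2 (1 + Nt * S n))
      - ∑ n, Real.logb 2 (∑ k, (covMatrix S n).det / (covMatrix S n + covMatrix S k).det))

/-- The normalized spatial modulation symbol `x = √Nt s e_a`: the constellation symbol `s` is sent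
on the active antenna `a`; every antenna has average power `1` if `s` has power `1` and `a` is
uniformly distributed. -/
def smSymbol (s : ℂ) (a : Fin Nt) : Fin Nt → ℂ :=
  Pi.single a ((Real.sqrt Nt : ℂ) * s)

/-- The mutual information `I(X; Y)` in nats, the Kullback–Leibler divergence of the joint law from
the product of the marginal laws. -/
def mutualInfo {Ω α β : Type*} [MeasurableSpace Ω] [MeasurableSpace α] [MeasurableSpace β]
    (X : Ω → α) (Y : Ω → β) (P : Measure Ω) : ℝ≥0∞ :=
  InformationTheory.klDiv (P.map (fun ω => (X ω, Y ω))) ((P.map X).prod (P.map Y))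

end SMLDM

end

/-! In the channel `y = x + w` the mutual information is `h(y) - h(w)`, where `w` is Gaussian and
`y` is a mixture of Gaussians with densities `p_n` and weights `c_n`, one component per active
antenna. So it suffices to bound `∫ T log T` from above for the mixture density `T = ∑ c_n p_n`.

For any soft decoder, i.e. positive functions `λ_n` with `∑ λ_n = 1`, write on the `n`-th component
`log T = log (c_n p_n) + log λ_n⁻¹ + log (λ_n T / (c_n p_n))`. Jensen's inequality bounds the mean
of the second term by `log ∫ p_n / λ_n`. By `log x ≤ x - 1`, the third terms contribute at most
`∑ (∫ λ_n T - c_n) = 0` in total.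

The choice `λ_n = h_n / ∑ h_k`, with `h_n` the density of `CN(0, 2 Σ_n)`, gives
`∫ p_n / λ_n = ∑ ∫ p_n h_k / h_n = 2 ^ N ∑ det Σ_n / det (Σ_n + Σ_k)`, as `p_n h_k / h_n` is again
proportional to a Gaussian density. The factor `2 ^ N` is the loss of `N` bits. -/

namespace SMLDM

section Density

variable {α E : Type*} [MeasurableSpace α] {μ : Measure α} {p : α → ℝ}
  [NormedAddCommGroup E] [NormedSpace ℝ E]

lemma integral_withDensity_ofReal (hp : Measurable p) (hp0 : ∀ x, 0 ≤ p x) (g : α → E) :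
    ∫ x, g x ∂(μ.withDensity fun x => ENNReal.ofReal (p x)) = ∫ x, p x • g x ∂μ := by
  simp [integral_withDensity_eq_integral_toReal_smul hp.ennreal_ofReal, hp0]

lemma integrable_withDensity_ofReal_iff (hp : Measurable p) (hp0 : ∀ x, 0 ≤ p x) {g : α → E} :
    Integrable g (μ.withDensity fun x => ENNReal.ofReal (p x)) ↔
      Integrable (fun x => p x • g x) μ := by
  simp [integrable_withDensity_iff_integrable_smul' hp.ennreal_ofReal, hp0]

lemma integrable_of_isFiniteMeasure_withDensity (hp : Measurable p) (hp0 : ∀ x, 0 ≤ p x)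
    [IsFiniteMeasure (μ.withDensity fun x => ENNReal.ofReal (p x))] : Integrable p μ := by
  simpa using (integrable_withDensity_ofReal_iff (μ := μ) hp hp0).1 (integrable_const (1 : ℝ))

lemma integral_eq_one_of_isProbabilityMeasure_withDensity (hp : Measurable p)
    (hp0 : ∀ x, 0 ≤ p x) [IsProbabilityMeasure (μ.withDensity fun x => ENNReal.ofReal (p x))] :
    ∫ x, p x ∂μ = 1 := by
  simpa using (integral_withDensity_ofReal (μ := μ) hp hp0 fun _ => (1 : ℝ)).symm

lemma integral_div_withDensity_ofReal (hp : Measurable p) (hp0 : ∀ x, 0 < p x) (g : α → ℝ) :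
    ∫ x, g x / p x ∂(μ.withDensity fun x => ENNReal.ofReal (p x)) = ∫ x, g x ∂μ := by
  simp only [integral_withDensity_ofReal hp fun x => (hp0 x).le, smul_eq_mul,
    mul_div_cancel₀ _ (hp0 _).ne']

lemma integrable_div_withDensity_ofReal_iff (hp : Measurable p) (hp0 : ∀ x, 0 < p x)
    {g : α → ℝ} : Integrable (fun x => g x / p x) (μ.withDensity fun x => ENNReal.ofReal (p x)) ↔
      Integrable g μ := by
  simp only [integrable_withDensity_ofReal_iff hp fun x => (hp0 x).le, smul_eq_mul,
    mul_div_cancel₀ _ (hp0 _).ne']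

lemma llr_withDensity_ofReal_ae_eq [SigmaFinite μ] (hp : Measurable p) (hp0 : ∀ x, 0 ≤ p x) :
    llr (μ.withDensity fun x => ENNReal.ofReal (p x)) μ
      =ᵐ[μ.withDensity fun x => ENNReal.ofReal (p x)] fun x => Real.log (p x) := by
  filter_upwards [(withDensity_absolutelyContinuous _ _).ae_le
    (Measure.rnDeriv_withDensity μ hp.ennreal_ofReal)] with x hx
  rw [llr, hx, ENNReal.toReal_ofReal (hp0 x)]

lemma map_withDensity_comp {β : Type*} [MeasurableSpace β] {ν : Measure β} {T : α → β}
    (hT : MeasurePreserving T μ ν) {f : β → ℝ≥0∞} (hf : Measurable f) :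
    (μ.withDensity (f ∘ T)).map T = ν.withDensity f := by
  ext s hs
  rw [Measure.map_apply hT.measurable hs, withDensity_apply _ (hT.measurable hs),
    withDensity_apply _ hs]
  exact hT.setLIntegral_comp_preimage hs hf

lemma sum_smul_withDensity_ofReal {κ : Type*} [Fintype κ] (c : κ → ℝ≥0) {p : κ → α → ℝ}
    (hp : ∀ n, Measurable (p n)) (hp0 : ∀ n x, 0 ≤ p n x) :
    ∑ n, c n • μ.withDensity (fun x => ENNReal.ofReal (p n x))
      = μ.withDensity fun x => ENNReal.ofReal (∑ n, c n * p n x) := by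
  have hsum (x : α) : ENNReal.ofReal (∑ n, c n * p n x) = ∑ n, c n * ENNReal.ofReal (p n x) := by
    rw [ENNReal.ofReal_sum_of_nonneg fun n _ => mul_nonneg (c n).coe_nonneg (hp0 n x)]
    simp only [ENNReal.ofReal_mul NNReal.zero_le_coe, ENNReal.ofReal_coe_nnreal]
  ext s hs
  simp_rw [Measure.finsetSum_apply, Measure.smul_apply, withDensity_apply _ hs, hsum]
  rw [lintegral_finsetSum _ fun n _ => (hp n).ennreal_ofReal.const_mul _]
  exact Finset.sum_congr rfl fun n _ => (lintegral_const_mul _ (hp n).ennreal_ofReal).symm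

lemma pi_withDensity_ofReal {ι : Type*} [Fintype ι] {β : ι → Type*}
    [∀ i, MeasurableSpace (β i)] {μ : ∀ i, Measure (β i)} [∀ i, SigmaFinite (μ i)]
    {f : ∀ i, β i → ℝ} (hf : ∀ i, Integrable (f i) (μ i)) (hf0 : ∀ i x, 0 ≤ f i x) :
    Measure.pi (fun i => (μ i).withDensity fun x => ENNReal.ofReal (f i x))
      = (Measure.pi μ).withDensity fun y => ENNReal.ofReal (∏ i, f i (y i)) := by
  have (i : ι) : IsFiniteMeasure ((μ i).withDensity fun x => ENNReal.ofReal (f i x)) :=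
    isFiniteMeasure_withDensity_ofReal (hf i).2
  refine Measure.pi_eq fun s hs => ?_
  have hbox : (Set.univ.pi s).indicator (fun y => ∏ i, f i (y i))
      = fun y => ∏ i, (s i).indicator (f i) (y i) := by
    ext y
    by_cases hy : y ∈ Set.univ.pi s
    · rw [Set.indicator_of_mem hy]
      exact Finset.prod_congr rfl fun i _ => (Set.indicator_of_mem (hy i trivial) _).symm
    · rw [Set.indicator_of_notMem hy]
      obtain ⟨i, hi⟩ : ∃ i, y i ∉ s i := by simpa [Set.mem_univ_pi] using hy
      exact (Finset.prod_eq_zero (Finset.mem_univ i) (Set.indicator_of_notMem hi _)).symm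
  calc (Measure.pi μ).withDensity (fun y => ENNReal.ofReal (∏ i, f i (y i))) (Set.univ.pi s)
      = ENNReal.ofReal (∫ y in Set.univ.pi s, ∏ i, f i (y i) ∂Measure.pi μ) := by
        rw [withDensity_apply _ (.univ_pi hs), ofReal_integral_eq_lintegral_ofReal
          (Integrable.fintype_prod_dep hf).integrableOn
          (ae_of_all _ fun y => Finset.prod_nonneg fun i _ => hf0 i (y i))]
    _ = ∏ i, ENNReal.ofReal (∫ x in s i, f i x ∂μ i) := by
        rw [← integral_indicator (.univ_pi hs), hbox, integral_fintype_prod_eq_prod,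
          ENNReal.ofReal_prod_of_nonneg fun i _ =>
            integral_nonneg fun x => Set.indicator_nonneg (fun x _ => hf0 i x) x]
        simp_rw [integral_indicator (hs _)]
    _ = ∏ i, (μ i).withDensity (fun x => ENNReal.ofReal (f i x)) (s i) := by
        simp_rw [withDensity_apply _ (hs _), ofReal_integral_eq_lintegral_ofReal
          (hf _).integrableOn (ae_of_all _ (hf0 _))]

end Density

section Independence

lemma pi_conv_pi {ι M : Type*} [Fintype ι] [AddMonoid M] [MeasurableSpace M] [MeasurableAdd₂ M]
    (μ ν : ι → Measure M) [∀ i, IsFiniteMeasure (μ i)] [∀ i, IsFiniteMeasure (ν i)] :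
    Measure.pi μ ∗ Measure.pi ν = Measure.pi fun i => μ i ∗ ν i := by
  have hsplit : (Measure.pi μ).prod (Measure.pi ν)
      = (Measure.pi fun i => (μ i).prod (ν i)).map
        (MeasurableEquiv.arrowProdEquivProdArrow M M ι) :=
    (measurePreserving_arrowProdEquivProdArrow M M ι μ ν).map_eq.symm
  unfold Measure.conv
  rw [hsplit, Measure.map_map measurable_add (MeasurableEquiv.measurable _),
    ← Measure.pi_map_pi fun _ => measurable_add.aemeasurable]
  rfl

lemma sum_smul_conv {M κ : Type*} [AddMonoid M] [MeasurableSpace M] [MeasurableAdd₂ M]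
    [Fintype κ] (c : κ → ℝ≥0∞) (μ : κ → Measure M) (ν : Measure M) [SFinite ν] :
    (∑ n, c n • μ n) ∗ ν = ∑ n, c n • (μ n ∗ ν) := by
  simp only [← Measure.sum_fintype, ← Measure.conv_smul_left]
  rw [Measure.conv, Measure.prod_sum_left, Measure.map_sum measurable_add.aemeasurable]
  rfl

lemma map_eq_sum_smul_map_of_indepFun {Ω β γ κ : Type*} [MeasurableSpace Ω] [MeasurableSpace β]
    [MeasurableSpace γ] [MeasurableSpace κ] [Fintype κ] [MeasurableSingletonClass κ]
    {P : Measure Ω} [IsFiniteMeasure P] {Z : Ω → β} {A : Ω → κ} (hZ : AEMeasurable Z P)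
    (hA : AEMeasurable A P) (hZA : IndepFun Z A P) {f : β → κ → γ}
    (hf : ∀ n, Measurable (f · n)) :
    P.map (fun ω => f (Z ω) (A ω)) = ∑ n, P (A ⁻¹' {n}) • (P.map Z).map (f · n) := by
  have hf' : Measurable (Function.uncurry f) := measurable_from_prod_countable_left hf
  have hlaw : P.map (fun ω => f (Z ω) (A ω))
      = ((P.map Z).prod (P.map A)).map (Function.uncurry f) := by
    rw [← (indepFun_iff_map_prod_eq_prod_map_map hZ hA).1 hZA,
      AEMeasurable.map_map_of_aemeasurable hf'.aemeasurable (hZ.prodMk hA)]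
    rfl
  ext s hs
  rw [hlaw, Measure.map_apply hf' hs, Measure.prod_apply_symm (hf' hs), lintegral_fintype,
    Measure.finsetSum_apply]
  refine Finset.sum_congr rfl fun n _ => ?_
  rw [Measure.smul_apply, smul_eq_mul, mul_comm, Measure.map_apply (hf n) hs,
    Measure.map_apply_of_aemeasurable hA (measurableSet_singleton n)]
  rfl

end Independence

section MixtureEntropy

variable {α : Type*} [MeasurableSpace α] {μ : Measure α}

lemma log_le_log_add_div_sub_one {x a : ℝ} (hx : 0 < x) (ha : 0 < a) :
    Real.log x ≤ Real.log a + x / a - 1 := by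
  have := Real.log_le_sub_one_of_pos (div_pos hx ha)
  rw [Real.log_div hx.ne' ha.ne'] at this
  linarith

-- Split `t = (c * p) * l⁻¹ * (l * t / (c * p))` and bound the logarithms of the last two factors by
-- their tangents at `a` and at `1`; integrating with `a = ∫ l⁻¹` makes the first tangent sharp.
lemma log_le_log_add_log_add_tangents {t c p l a : ℝ} (ht : 0 < t) (hc : 0 < c) (hp : 0 < p)
    (hl : 0 < l) (ha : 0 < a) :
    Real.log t ≤ Real.log p + l⁻¹ / a + l * t / p / c + (Real.log c + Real.log a - 2) := by
  have hinv := log_le_log_add_div_sub_one (inv_pos.2 hl) ha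
  have hratio := log_le_log_add_div_sub_one (mul_pos hl ht) (mul_pos hp hc)
  rw [Real.log_mul hl.ne' ht.ne', Real.log_mul hp.ne' hc.ne', ← div_div] at hratio
  rw [Real.log_inv] at hinv
  linarith

lemma integral_log_le_add_log_integral_inv {p t l : α → ℝ} {c : ℝ} (hc : 0 < c)
    (hp : Measurable p) (hp0 : ∀ y, 0 < p y) (ht0 : ∀ y, 0 < t y) (hl0 : ∀ y, 0 < l y)
    {ν : Measure α} [IsProbabilityMeasure ν] (hν : ν = μ.withDensity fun y => ENNReal.ofReal (p y))
    (hlogp : Integrable (fun y => Real.log (p y)) ν)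
    (hlogt : Integrable (fun y => Real.log (t y)) ν) (hl : Integrable (fun y => (l y)⁻¹) ν)
    (hlt : Integrable (fun y => l y * t y) μ) :
    ∫ y, Real.log (t y) ∂ν ≤ Real.log c + ∫ y, Real.log (p y) ∂ν + Real.log (∫ y, (l y)⁻¹ ∂ν)
      + (∫ y, l y * t y ∂μ) / c - 1 := by
  set A := ∫ y, (l y)⁻¹ ∂ν
  have hA : 0 < A := by
    refine (integral_pos_iff_support_of_nonneg (fun y => (inv_pos.2 (hl0 y)).le) hl).2 ?_
    simp [Function.support, (hl0 _).ne']
  have hratio : Integrable (fun y => l y * t y / p y) ν := by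
    rwa [hν, integrable_div_withDensity_ofReal_iff hp hp0]
  have hratio_val : ∫ y, l y * t y / p y ∂ν = ∫ y, l y * t y ∂μ := by
    rw [hν, integral_div_withDensity_ofReal hp hp0]
  have hlin := hlogp.fun_add (hl.div_const A)
  have hlin' := hlin.fun_add (hratio.div_const c)
  calc ∫ y, Real.log (t y) ∂ν
      ≤ ∫ y, (Real.log (p y) + (l y)⁻¹ / A + l y * t y / p y / c
          + (Real.log c + Real.log A - 2)) ∂ν :=
        integral_mono hlogt (hlin'.add (integrable_const _)) fun y =>
          log_le_log_add_log_add_tangents (ht0 y) hc (hp0 y) (hl0 y) hA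
    _ = _ := by
        rw [integral_add hlin' (integrable_const _), integral_add hlin (hratio.div_const c),
          integral_add hlogp (hl.div_const A), integral_div, integral_div, hratio_val,
          div_self hA.ne', integral_const, probReal_univ, one_smul]
        ring

lemma integrable_mul_of_sum_eq_one {κ : Type*} [Fintype κ] {t : α → ℝ} (ht : Integrable t μ)
    {l : κ → α → ℝ} (hl : ∀ n, Measurable (l n)) (hl0 : ∀ n y, 0 ≤ l n y)
    (hl1 : ∀ y, ∑ n, l n y = 1) (n : κ) : Integrable (fun y => l n y * t y) μ := by
  refine ht.bdd_mul (c := 1) (hl n).aestronglyMeasurable (ae_of_all _ fun y => ?_)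
  rw [Real.norm_of_nonneg (hl0 n y), ← hl1 y]
  exact Finset.single_le_sum (f := fun k => l k y) (fun k _ => hl0 k y) (Finset.mem_univ n)

lemma integral_log_mixture_le {κ : Type*} [Fintype κ] {c : κ → ℝ≥0} (hc : ∀ n, 0 < c n)
    {p l : κ → α → ℝ} (hp : ∀ n, Measurable (p n)) (hl : ∀ n, Measurable (l n))
    (hp0 : ∀ n y, 0 < p n y) (hl0 : ∀ n y, 0 < l n y) (hl1 : ∀ y, ∑ n, l n y = 1)
    {ν : κ → Measure α} [∀ n, IsProbabilityMeasure (ν n)]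
    (hν : ∀ n, ν n = μ.withDensity fun y => ENNReal.ofReal (p n y))
    (hlogp : ∀ n, Integrable (fun y => Real.log (p n y)) (ν n))
    (hlogt : ∀ n, Integrable (fun y => Real.log (∑ k, c k * p k y)) (ν n))
    (hl_inv : ∀ n, Integrable (fun y => (l n y)⁻¹) (ν n)) :
    ∫ y, Real.log (∑ k, c k * p k y) ∂(∑ n, c n • ν n)
      ≤ ∑ n, c n * (Real.log (c n) + ∫ y, Real.log (p n y) ∂ν n
        + Real.log (∫ y, (l n y)⁻¹ ∂ν n)) := by
  rcases isEmpty_or_nonempty κ with hκ | hκ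
  · simp
  set t : α → ℝ := fun y => ∑ k, c k * p k y
  have hcp (n : κ) (y : α) : 0 < c n * p n y := mul_pos (NNReal.coe_pos.2 (hc n)) (hp0 n y)
  have ht0 (y : α) : 0 < t y := Finset.sum_pos (fun k _ => hcp k y) Finset.univ_nonempty
  have hprob (n : κ) : IsProbabilityMeasure (μ.withDensity fun y => ENNReal.ofReal (p n y)) :=
    hν n ▸ inferInstance
  have hp_int (n : κ) : Integrable (p n) μ :=
    integrable_of_isFiniteMeasure_withDensity (hp n) fun y => (hp0 n y).le
  have hp_one (n : κ) : ∫ y, p n y ∂μ = 1 :=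
    integral_eq_one_of_isProbabilityMeasure_withDensity (hp n) fun y => (hp0 n y).le
  have ht_int : Integrable t μ := integrable_finsetSum _ fun k _ => (hp_int k).const_mul _
  have hlt_int (n : κ) : Integrable (fun y => l n y * t y) μ :=
    integrable_mul_of_sum_eq_one ht_int hl (fun n y => (hl0 n y).le) hl1 n
  have hlt_sum : ∑ n, ∫ y, l n y * t y ∂μ = ∑ n, (c n : ℝ) := by
    rw [← integral_finsetSum _ fun n _ => hlt_int n]
    simp only [← Finset.sum_mul, hl1, one_mul]
    rw [integral_finsetSum _ fun k _ => (hp_int k).const_mul _]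
    simp only [integral_const_mul, hp_one, mul_one]
  rw [integral_finsetSum_measure fun n _ => (hlogt n).smul_measure_nnreal]
  simp only [integral_smul_nnreal_measure, NNReal.smul_def, smul_eq_mul]
  calc ∑ n, c n * ∫ y, Real.log (t y) ∂ν n
      ≤ ∑ n, c n * (Real.log (c n) + ∫ y, Real.log (p n y) ∂ν n
          + Real.log (∫ y, (l n y)⁻¹ ∂ν n) + (∫ y, l n y * t y ∂μ) / c n - 1) :=
        Finset.sum_le_sum fun n _ => mul_le_mul_of_nonneg_left
          (integral_log_le_add_log_integral_inv (NNReal.coe_pos.2 (hc n)) (hp n) (hp0 n) ht0 (hl0 n)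
            (hν n) (hlogp n) (hlogt n) (hl_inv n) (hlt_int n)) (c n).coe_nonneg
    _ = ∑ n, (c n * (Real.log (c n) + ∫ y, Real.log (p n y) ∂ν n
          + Real.log (∫ y, (l n y)⁻¹ ∂ν n)) + ∫ y, l n y * t y ∂μ - c n) :=
        Finset.sum_congr rfl fun n _ => by
          have := (hc n).ne'
          field_simp
    _ = _ := by rw [Finset.sum_sub_distrib, Finset.sum_add_distrib, hlt_sum, add_sub_cancel_right]

end MixtureEntropy

section ComplexGaussian

/-- The density of `CN(0, v)` with respect to the Lebesgue measure on `ℂ`, for `0 < v`. -/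
noncomputable def complexGaussianPDFReal (v : ℝ) (z : ℂ) : ℝ :=
  (Real.pi * v)⁻¹ * Real.exp (-‖z‖ ^ 2 / v)

variable {u v : ℝ}

lemma sq_norm_add_mul_I (x y : ℝ) : ‖(x : ℂ) + y * Complex.I‖ ^ 2 = x ^ 2 + y ^ 2 := by
  rw [Complex.norm_add_mul_I, Real.sq_sqrt (by positivity)]

lemma complexGaussianPDFReal_pos (hv : 0 < v) (z : ℂ) : 0 < complexGaussianPDFReal v z := by
  unfold complexGaussianPDFReal; positivity

lemma complexGaussianPDFReal_le (hv : 0 < v) (z : ℂ) :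
    complexGaussianPDFReal v z ≤ (Real.pi * v)⁻¹ :=
  mul_le_of_le_one_right (by positivity) <| Real.exp_le_one_iff.2 <|
    div_nonpos_of_nonpos_of_nonneg (neg_nonpos.2 (by positivity)) hv.le

lemma log_complexGaussianPDFReal (hv : 0 < v) (z : ℂ) :
    Real.log (complexGaussianPDFReal v z) = -Real.log (Real.pi * v) - ‖z‖ ^ 2 / v := by
  rw [complexGaussianPDFReal, Real.log_mul (by positivity) (Real.exp_pos _).ne', Real.log_inv,
    Real.log_exp]
  ring

@[fun_prop]
lemma measurable_complexGaussianPDFReal (v : ℝ) : Measurable (complexGaussianPDFReal v) := by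
  unfold complexGaussianPDFReal; fun_prop

lemma gaussianPDFReal_mul_gaussianPDFReal (hv : 0 < v) (x y : ℝ) :
    gaussianPDFReal 0 (v / 2).toNNReal x * gaussianPDFReal 0 (v / 2).toNNReal y
      = complexGaussianPDFReal v (x + y * Complex.I) := by
  have hvar : 2 * Real.pi * ((v / 2).toNNReal : ℝ) = Real.pi * v := by
    rw [Real.coe_toNNReal _ (by positivity)]; ring
  rw [gaussianPDFReal, gaussianPDFReal, complexGaussianPDFReal, sq_norm_add_mul_I, hvar,
    mul_mul_mul_comm, ← mul_inv, Real.mul_self_sqrt (by positivity), ← Real.exp_add,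
    Real.coe_toNNReal _ (by positivity)]
  congr 2
  ring

instance isProbabilityMeasure_complexGaussian (v : ℝ) :
    IsProbabilityMeasure (complexGaussian v) := by
  unfold complexGaussian
  exact Measure.isProbabilityMeasure_map (by fun_prop)

lemma complexGaussian_eq_withDensity (hv : 0 < v) :
    complexGaussian v
      = volume.withDensity fun z => ENNReal.ofReal (complexGaussianPDFReal v z) := by
  have hvar : (v / 2).toNNReal ≠ 0 := (Real.toNNReal_pos.2 (half_pos hv)).ne'
  have hequiv : (fun p : ℝ × ℝ => (p.1 : ℂ) + (p.2 : ℂ) * Complex.I)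
      = Complex.measurableEquivRealProd.symm := by
    ext p
    rw [Complex.measurableEquivRealProd_symm_apply, Complex.mk_eq_add_mul_I]
  have hpdf : (fun p : ℝ × ℝ => gaussianPDF 0 (v / 2).toNNReal p.1
      * gaussianPDF 0 (v / 2).toNNReal p.2) =
      (fun z => ENNReal.ofReal (complexGaussianPDFReal v z))
        ∘ fun p : ℝ × ℝ => (p.1 : ℂ) + (p.2 : ℂ) * Complex.I := by
    ext p
    simp only [gaussianPDF, Function.comp_apply]
    rw [← ENNReal.ofReal_mul (gaussianPDFReal_nonneg _ _ _), gaussianPDFReal_mul_gaussianPDFReal hv]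
  rw [complexGaussian, gaussianReal_of_var_ne_zero _ hvar,
    prod_withDensity (by fun_prop) (by fun_prop), hpdf, hequiv]
  exact map_withDensity_comp Complex.volume_preserving_equiv_real_prod.symm (by fun_prop)

lemma integrable_complexGaussianPDFReal (hv : 0 < v) : Integrable (complexGaussianPDFReal v) := by
  have : IsProbabilityMeasure
      (volume.withDensity fun z => ENNReal.ofReal (complexGaussianPDFReal v z)) :=
    complexGaussian_eq_withDensity hv ▸ inferInstance
  exact integrable_of_isFiniteMeasure_withDensity (by fun_prop)
    fun z => (complexGaussianPDFReal_pos hv z).le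

lemma charFun_complexGaussian (hv : 0 ≤ v) (t : ℂ) :
    charFun (complexGaussian v) t = Complex.exp (-(v * ‖t‖ ^ 2 / 4 : ℝ)) := by
  have hsplit (p : ℝ × ℝ) :
      Complex.exp (inner ℝ ((p.1 : ℂ) + (p.2 : ℂ) * Complex.I) t * Complex.I)
        = Complex.exp (t.re * p.1 * Complex.I) * Complex.exp (t.im * p.2 * Complex.I) := by
    rw [← Complex.exp_add, Complex.inner]
    congr 1
    simp
    ring
  rw [charFun_apply, complexGaussian, integral_map (by fun_prop) (by fun_prop)]
  simp_rw [hsplit]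
  rw [integral_prod_mul (fun x : ℝ => Complex.exp (t.re * x * Complex.I))
    (fun x : ℝ => Complex.exp (t.im * x * Complex.I)), ← charFun_apply_real, ← charFun_apply_real,
    charFun_gaussianReal, charFun_gaussianReal, ← Complex.exp_add, Complex.sq_norm,
    Complex.normSq_apply, Real.coe_toNNReal _ (by positivity)]
  congr 1
  push_cast
  ring

lemma complexGaussian_conv (hu : 0 ≤ u) (hv : 0 ≤ v) :
    complexGaussian u ∗ complexGaussian v = complexGaussian (u + v) := by
  refine Measure.ext_of_charFun (funext fun t => ?_)
  rw [charFun_conv, charFun_complexGaussian hu, charFun_complexGaussian hv,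
    charFun_complexGaussian (add_nonneg hu hv), ← Complex.exp_add]
  congr 1
  push_cast
  ring

lemma complexGaussian_map_mul (hv : 0 ≤ v) (r : ℝ) :
    (complexGaussian v).map (fun z => (r : ℂ) * z) = complexGaussian (r ^ 2 * v) := by
  simp_rw [← Complex.real_smul]
  have : IsProbabilityMeasure ((complexGaussian v).map fun z : ℂ => r • z) :=
    Measure.isProbabilityMeasure_map (by fun_prop)
  refine Measure.ext_of_charFun (funext fun t => ?_)
  rw [charFun_map_smul, charFun_complexGaussian hv, charFun_complexGaussian (by positivity),
    norm_smul, mul_pow, Real.norm_eq_abs, sq_abs]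
  congr 3
  ring

lemma integrable_norm_sq_complexGaussian (v : ℝ) :
    Integrable (fun z : ℂ => ‖z‖ ^ 2) (complexGaussian v) := by
  have h : Integrable (fun x : ℝ => x ^ 2) (gaussianReal 0 (v / 2).toNNReal) :=
    (memLp_id_gaussianReal 2).integrable_sq
  rw [complexGaussian, integrable_map_measure (by fun_prop) (by fun_prop)]
  simpa only [Function.comp_def, sq_norm_add_mul_I]
    using (h.comp_fst _).fun_add (h.comp_snd _)

lemma integral_norm_sq_complexGaussian (hv : 0 ≤ v) :
    ∫ z, ‖z‖ ^ 2 ∂(complexGaussian v) = v := by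
  have h : Integrable (fun x : ℝ => x ^ 2) (gaussianReal 0 (v / 2).toNNReal) :=
    (memLp_id_gaussianReal 2).integrable_sq
  have hvar : ∫ x, x ^ 2 ∂(gaussianReal 0 (v / 2).toNNReal) = v / 2 := by
    rw [← variance_of_integral_eq_zero (X := fun x => x) (by fun_prop) (by simp),
      variance_fun_id_gaussianReal, Real.coe_toNNReal _ (by positivity)]
  rw [complexGaussian, integral_map (by fun_prop) (by fun_prop)]
  simp_rw [sq_norm_add_mul_I]
  rw [integral_add (h.comp_fst _) (h.comp_snd _), integral_fun_fst (fun x : ℝ => x ^ 2),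
    integral_fun_snd (fun x : ℝ => x ^ 2), hvar]
  simp

lemma complexGaussianPDFReal_mul_div (hu : 0 < u) (hv : 0 < v) (z : ℂ) :
    complexGaussianPDFReal u z
        * (complexGaussianPDFReal (2 * v) z / complexGaussianPDFReal (2 * u) z)
      = 2 * u / (u + v) * complexGaussianPDFReal (2 * u * v / (u + v)) z := by
  have hexp : Real.exp (-‖z‖ ^ 2 / u) * (Real.exp (-‖z‖ ^ 2 / (2 * v))
      / Real.exp (-‖z‖ ^ 2 / (2 * u))) = Real.exp (-‖z‖ ^ 2 / (2 * u * v / (u + v))) := by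
    rw [← Real.exp_sub, ← Real.exp_add]
    congr 1
    field_simp
    ring
  unfold complexGaussianPDFReal
  rw [← hexp]
  field_simp

end ComplexGaussian

section ComplexGaussianDiag

variable {N : ℕ}

/-- The density of `CN(0, diag d)` with respect to the Lebesgue measure on `ℂ^N`, for positive
variances `d i`. -/
noncomputable def complexGaussianDiagPDFReal (d : Fin N → ℝ) (y : Fin N → ℂ) : ℝ :=
  ∏ i, complexGaussianPDFReal (d i) (y i)

instance isProbabilityMeasure_complexGaussianDiag (d : Fin N → ℝ) :
    IsProbabilityMeasure (complexGaussianDiag d) := by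
  unfold complexGaussianDiag; infer_instance

@[fun_prop]
lemma measurable_complexGaussianDiagPDFReal (d : Fin N → ℝ) :
    Measurable (complexGaussianDiagPDFReal d) := by
  unfold complexGaussianDiagPDFReal; fun_prop

lemma complexGaussianDiag_conv {d e : Fin N → ℝ} (hd : ∀ i, 0 ≤ d i) (he : ∀ i, 0 ≤ e i) :
    complexGaussianDiag d ∗ complexGaussianDiag e = complexGaussianDiag (d + e) := by
  simp only [complexGaussianDiag, pi_conv_pi, complexGaussian_conv (hd _) (he _), Pi.add_apply]

lemma integrable_norm_sq_eval_complexGaussianDiag (d : Fin N → ℝ) (i : Fin N) :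
    Integrable (fun y : Fin N → ℂ => ‖y i‖ ^ 2) (complexGaussianDiag d) :=
  integrable_comp_eval (μ := fun i => complexGaussian (d i)) (f := fun z : ℂ => ‖z‖ ^ 2)
    (integrable_norm_sq_complexGaussian (d i))

lemma integral_norm_sq_eval_complexGaussianDiag {d : Fin N → ℝ} {i : Fin N} (hd : 0 ≤ d i) :
    ∫ y, ‖y i‖ ^ 2 ∂(complexGaussianDiag d) = d i :=
  (integral_comp_eval (μ := fun i => complexGaussian (d i)) (f := fun z : ℂ => ‖z‖ ^ 2)
    (by fun_prop)).trans (integral_norm_sq_complexGaussian hd)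

variable {d : Fin N → ℝ} (hd : ∀ i, 0 < d i)
include hd

lemma complexGaussianDiagPDFReal_pos (y : Fin N → ℂ) : 0 < complexGaussianDiagPDFReal d y :=
  Finset.prod_pos fun i _ => complexGaussianPDFReal_pos (hd i) (y i)

lemma complexGaussianDiagPDFReal_le (y : Fin N → ℂ) :
    complexGaussianDiagPDFReal d y ≤ ∏ i, (Real.pi * d i)⁻¹ :=
  Finset.prod_le_prod (fun i _ => (complexGaussianPDFReal_pos (hd i) (y i)).le)
    fun i _ => complexGaussianPDFReal_le (hd i) (y i)

lemma complexGaussianDiag_eq_withDensity :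
    complexGaussianDiag d
      = volume.withDensity fun y => ENNReal.ofReal (complexGaussianDiagPDFReal d y) := by
  simp only [complexGaussianDiag, complexGaussian_eq_withDensity (hd _)]
  exact pi_withDensity_ofReal (fun i => integrable_complexGaussianPDFReal (hd i))
    fun i z => (complexGaussianPDFReal_pos (hd i) z).le

lemma integrable_complexGaussianDiagPDFReal : Integrable (complexGaussianDiagPDFReal d) :=
  Integrable.fintype_prod fun i => integrable_complexGaussianPDFReal (hd i)

lemma integral_complexGaussianDiagPDFReal : ∫ y, complexGaussianDiagPDFReal d y = 1 := by
  have : IsProbabilityMeasure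
      (volume.withDensity fun y => ENNReal.ofReal (complexGaussianDiagPDFReal d y)) :=
    complexGaussianDiag_eq_withDensity hd ▸ inferInstance
  exact integral_eq_one_of_isProbabilityMeasure_withDensity (by fun_prop)
    fun y => (complexGaussianDiagPDFReal_pos hd y).le

lemma log_complexGaussianDiagPDFReal (y : Fin N → ℂ) :
    Real.log (complexGaussianDiagPDFReal d y)
      = ∑ i, (-Real.log (Real.pi * d i) - ‖y i‖ ^ 2 / d i) := by
  rw [complexGaussianDiagPDFReal,
    Real.log_prod fun i _ => (complexGaussianPDFReal_pos (hd i) (y i)).ne']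
  exact Finset.sum_congr rfl fun i _ => log_complexGaussianPDFReal (hd i) (y i)

lemma integrable_log_complexGaussianDiagPDFReal (e : Fin N → ℝ) :
    Integrable (fun y => Real.log (complexGaussianDiagPDFReal d y)) (complexGaussianDiag e) := by
  simp_rw [log_complexGaussianDiagPDFReal hd]
  exact integrable_finsetSum _ fun i _ =>
    (integrable_const _).sub ((integrable_norm_sq_eval_complexGaussianDiag e i).div_const _)

lemma integral_log_complexGaussianDiagPDFReal :
    ∫ y, Real.log (complexGaussianDiagPDFReal d y) ∂(complexGaussianDiag d)
      = -∑ i, Real.log (Real.pi * d i) - N := by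
  have hnorm (i : Fin N) :=
    (integrable_norm_sq_eval_complexGaussianDiag d i).div_const (d i)
  have hcoord (i : Fin N) : ∫ y, (-Real.log (Real.pi * d i) - ‖y i‖ ^ 2 / d i)
      ∂(complexGaussianDiag d) = -Real.log (Real.pi * d i) - 1 := by
    rw [integral_sub (integrable_const _) (hnorm i), integral_div,
      integral_norm_sq_eval_complexGaussianDiag (hd i).le, div_self (hd i).ne', integral_const,
      probReal_univ, one_smul]
  have hint (i : Fin N) : Integrable (fun y : Fin N → ℂ => -Real.log (Real.pi * d i)
      - ‖y i‖ ^ 2 / d i) (complexGaussianDiag d) := (integrable_const _).sub (hnorm i)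
  simp_rw [log_complexGaussianDiagPDFReal hd]
  rw [integral_finsetSum _ fun i _ => hint i]
  simp [hcoord, Finset.sum_sub_distrib]

section Ratio

variable {e : Fin N → ℝ} (he : ∀ i, 0 < e i)
include he

lemma complexGaussianDiagPDFReal_mul_div (y : Fin N → ℂ) :
    complexGaussianDiagPDFReal d y
        * (complexGaussianDiagPDFReal (2 • e) y / complexGaussianDiagPDFReal (2 • d) y)
      = (∏ i, 2 * d i / (d i + e i))
        * complexGaussianDiagPDFReal (fun i => 2 * d i * e i / (d i + e i)) y := by
  simp only [complexGaussianDiagPDFReal, Pi.smul_apply, nsmul_eq_mul, Nat.cast_ofNat,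
    ← Finset.prod_div_distrib, ← Finset.prod_mul_distrib,
    complexGaussianPDFReal_mul_div (hd _) (he _)]

lemma integrable_complexGaussianDiagPDFReal_div :
    Integrable (fun y => complexGaussianDiagPDFReal (2 • e) y
      / complexGaussianDiagPDFReal (2 • d) y) (complexGaussianDiag d) := by
  rw [complexGaussianDiag_eq_withDensity hd, integrable_withDensity_ofReal_iff
    (by fun_prop) fun y => (complexGaussianDiagPDFReal_pos hd y).le]
  simp_rw [smul_eq_mul, complexGaussianDiagPDFReal_mul_div hd he]
  exact (integrable_complexGaussianDiagPDFReal fun i =>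
    div_pos (mul_pos (mul_pos two_pos (hd i)) (he i)) (add_pos (hd i) (he i))).const_mul _

lemma integral_complexGaussianDiagPDFReal_div :
    ∫ y, complexGaussianDiagPDFReal (2 • e) y / complexGaussianDiagPDFReal (2 • d) y
      ∂(complexGaussianDiag d) = ∏ i, 2 * d i / (d i + e i) := by
  rw [complexGaussianDiag_eq_withDensity hd, integral_withDensity_ofReal
    (by fun_prop) fun y => (complexGaussianDiagPDFReal_pos hd y).le]
  simp_rw [smul_eq_mul, complexGaussianDiagPDFReal_mul_div hd he]
  rw [integral_const_mul, integral_complexGaussianDiagPDFReal fun i =>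
    div_pos (mul_pos (mul_pos two_pos (hd i)) (he i)) (add_pos (hd i) (he i)), mul_one]

end Ratio

end ComplexGaussianDiag

section GaussianMixture

variable {N : ℕ} {κ : Type*} [Fintype κ]

lemma sum_smul_complexGaussianDiag_eq_withDensity (c : κ → ℝ≥0) {v : κ → Fin N → ℝ}
    (hv : ∀ n i, 0 < v n i) :
    ∑ n, c n • complexGaussianDiag (v n)
      = volume.withDensity fun y =>
        ENNReal.ofReal (∑ n, c n * complexGaussianDiagPDFReal (v n) y) := by
  simp only [complexGaussianDiag_eq_withDensity (hv _)]
  exact sum_smul_withDensity_ofReal c (fun n => measurable_complexGaussianDiagPDFReal (v n))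
    fun n y => (complexGaussianDiagPDFReal_pos (hv n) y).le

variable [Nonempty κ] {c : κ → ℝ≥0} (hc : ∀ n, 0 < c n) {v : κ → Fin N → ℝ} (hv : ∀ n i, 0 < v n i)
include hc hv

lemma sum_mul_complexGaussianDiagPDFReal_pos (y : Fin N → ℂ) :
    0 < ∑ n, c n * complexGaussianDiagPDFReal (v n) y :=
  Finset.sum_pos (fun n _ => mul_pos (NNReal.coe_pos.2 (hc n))
    (complexGaussianDiagPDFReal_pos (hv n) y)) Finset.univ_nonempty

lemma integrable_log_gaussianMixture (e : Fin N → ℝ) :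
    Integrable (fun y => Real.log (∑ n, c n * complexGaussianDiagPDFReal (v n) y))
      (complexGaussianDiag e) := by
  obtain ⟨m⟩ := ‹Nonempty κ›
  have hcm : (0 : ℝ) < c m := NNReal.coe_pos.2 (hc m)
  refine integrable_of_le_of_le (by fun_prop : Measurable _).aestronglyMeasurable
    (ae_of_all _ fun y => ?_) (ae_of_all _ fun y => ?_)
    ((integrable_const (Real.log (c m))).add (integrable_log_complexGaussianDiagPDFReal (hv m) e))
    (integrable_const (Real.log (∑ n, c n * ∏ i, (Real.pi * v n i)⁻¹)))
  · have hpm := complexGaussianDiagPDFReal_pos (hv m) y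
    rw [Pi.add_apply, ← Real.log_mul hcm.ne' hpm.ne']
    exact Real.log_le_log (mul_pos hcm hpm) <|
      Finset.single_le_sum (f := fun n => c n * complexGaussianDiagPDFReal (v n) y)
        (fun n _ => mul_nonneg (c n).coe_nonneg (complexGaussianDiagPDFReal_pos (hv n) y).le)
        (Finset.mem_univ m)
  · exact Real.log_le_log (sum_mul_complexGaussianDiagPDFReal_pos hc hv y) <|
      Finset.sum_le_sum fun n _ => mul_le_mul_of_nonneg_left
        (complexGaussianDiagPDFReal_le (hv n) y) (c n).coe_nonneg

lemma integral_log_gaussianMixture_le :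
    ∫ y, Real.log (∑ k, c k * complexGaussianDiagPDFReal (v k) y)
        ∂(∑ n, c n • complexGaussianDiag (v n))
      ≤ ∑ n, c n * (Real.log (c n) + (-∑ i, Real.log (Real.pi * v n i) - N)
        + Real.log (∑ k, ∏ i, 2 * v n i / (v n i + v k i))) := by
  -- Reweighting with doubled covariances makes `p n * h k / h n` a multiple of a Gaussian density;
  -- undoubled ones would leave `p k`, with integral one, and hence a bound blind to the separation.
  set h : κ → (Fin N → ℂ) → ℝ := fun n => complexGaussianDiagPDFReal (2 • v n)
  have h_pos (n : κ) (y : Fin N → ℂ) : 0 < h n y :=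
    complexGaussianDiagPDFReal_pos (fun i => nsmul_pos (hv n i) two_ne_zero) y
  have h_meas (n : κ) : Measurable (h n) := measurable_complexGaussianDiagPDFReal _
  have hsum_pos (y : Fin N → ℂ) : 0 < ∑ k, h k y :=
    Finset.sum_pos (fun k _ => h_pos k y) Finset.univ_nonempty
  have hinv (n : κ) (y : Fin N → ℂ) : (h n y / ∑ k, h k y)⁻¹ = ∑ k, h k y / h n y := by
    rw [inv_div, Finset.sum_div]
  have hinv_int (n k : κ) : Integrable (fun y => h k y / h n y) (complexGaussianDiag (v n)) :=
    integrable_complexGaussianDiagPDFReal_div (hv n) (hv k)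
  have hinv_val (n : κ) : ∫ y, (h n y / ∑ k, h k y)⁻¹ ∂(complexGaussianDiag (v n))
      = ∑ k, ∏ i, 2 * v n i / (v n i + v k i) := by
    simp_rw [hinv]
    rw [integral_finsetSum _ fun k _ => hinv_int n k]
    exact Finset.sum_congr rfl fun k _ => integral_complexGaussianDiagPDFReal_div (hv n) (hv k)
  simp only [← integral_log_complexGaussianDiagPDFReal (hv _), ← hinv_val]
  refine integral_log_mixture_le hc (by fun_prop) (by fun_prop)
    (fun n y => complexGaussianDiagPDFReal_pos (hv n) y)
    (fun n y => div_pos (h_pos n y) (hsum_pos y)) (fun y => ?_)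
    (fun n => complexGaussianDiag_eq_withDensity (hv n))
    (fun n => integrable_log_complexGaussianDiagPDFReal (hv n) (v n))
    (fun n => integrable_log_gaussianMixture hc hv (v n)) fun n => ?_
  · rw [← Finset.sum_div, div_self (hsum_pos y).ne']
  · simp_rw [hinv]
    exact integrable_finsetSum _ fun k _ => hinv_int n k

end GaussianMixture

section AdditiveNoise

section KullbackLeibler

variable {α : Type*} [MeasurableSpace α] {μ : Measure α} [IsFiniteMeasure μ] {p : α → ℝ}

lemma klDiv_withDensity_ofReal_ne_top (hp : Measurable p) (hp0 : ∀ x, 0 ≤ p x)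
    (hlog : Integrable (fun x => Real.log (p x)) (μ.withDensity fun x => ENNReal.ofReal (p x))) :
    InformationTheory.klDiv (μ.withDensity fun x => ENNReal.ofReal (p x)) μ ≠ ∞ :=
  InformationTheory.klDiv_ne_top (withDensity_absolutelyContinuous _ _)
    (hlog.congr (llr_withDensity_ofReal_ae_eq hp hp0).symm)

lemma toReal_klDiv_withDensity_ofReal
    [IsFiniteMeasure (μ.withDensity fun x => ENNReal.ofReal (p x))] (hp : Measurable p)
    (hp0 : ∀ x, 0 ≤ p x)
    (hmass : μ.withDensity (fun x => ENNReal.ofReal (p x)) Set.univ = μ Set.univ) :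
    (InformationTheory.klDiv (μ.withDensity fun x => ENNReal.ofReal (p x)) μ).toReal
      = ∫ x, Real.log (p x) ∂(μ.withDensity fun x => ENNReal.ofReal (p x)) := by
  rw [InformationTheory.toReal_klDiv_of_measure_eq (withDensity_absolutelyContinuous _ _) hmass,
    integral_congr_ae (llr_withDensity_ofReal_ae_eq hp hp0)]

end KullbackLeibler

variable {Ω G : Type*} [MeasurableSpace Ω] [AddCommGroup G] [MeasurableSpace G]
  [MeasurableAdd₂ G] [MeasurableSub₂ G] {P : Measure Ω} [IsProbabilityMeasure P] {X W : Ω → G}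
  (hX : AEMeasurable X P) (hW : AEMeasurable W P) (hXW : IndepFun X W P)
  {μ : Measure G} [SigmaFinite μ] [μ.IsAddRightInvariant]
include hX hW hXW

lemma map_add_prodMk_eq_withDensity {f : G → ℝ≥0∞} (hf : Measurable f)
    (hWf : P.map W = μ.withDensity f) :
    P.map (fun ω => (X ω + W ω, X ω)) = (μ.prod (P.map X)).withDensity fun z => f (z.1 - z.2) := by
  have hWX : P.map (fun ω => (W ω, X ω)) = (μ.prod (P.map X)).withDensity fun z => f z.1 := by
    rw [(indepFun_iff_map_prod_eq_prod_map_map hW hX).1 hXW.symm, hWf, prod_withDensity_left hf]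
  have hT : MeasurePreserving (fun z : G × G => (z.1 + z.2, z.2)) (μ.prod (P.map X))
      (μ.prod (P.map X)) := measurePreserving_add_prod μ (P.map X)
  have hfT : (fun z : G × G => f z.1)
      = (fun z : G × G => f (z.1 - z.2)) ∘ fun z : G × G => (z.1 + z.2, z.2) := by
    ext z
    simp
  calc P.map (fun ω => (X ω + W ω, X ω))
      = (P.map fun ω => (W ω, X ω)).map fun z => (z.1 + z.2, z.2) := by
        rw [AEMeasurable.map_map_of_aemeasurable hT.measurable.aemeasurable (hW.prodMk hX)]
        simp only [Function.comp_def, add_comm]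
    _ = (μ.prod (P.map X)).withDensity fun z => f (z.1 - z.2) := by
        rw [hWX, hfT]
        exact map_withDensity_comp hT (by fun_prop)

variable {f q : G → ℝ} (hf : Measurable f) (hq : Measurable q) (hf0 : ∀ y, 0 < f y)
  (hq0 : ∀ y, 0 < q y) (hWf : P.map W = μ.withDensity fun y => ENNReal.ofReal (f y))
  (hYq : P.map (fun ω => X ω + W ω) = μ.withDensity fun y => ENNReal.ofReal (q y))
include hf hq hq0 hWf hYq

lemma map_add_prodMk_eq_withDensity_div :
    P.map (fun ω => (X ω + W ω, X ω)) = ((P.map fun ω => X ω + W ω).prod (P.map X)).withDensity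
      fun z => ENNReal.ofReal (f (z.1 - z.2) / q z.1) := by
  rw [map_add_prodMk_eq_withDensity hX hW hXW hf.ennreal_ofReal hWf, hYq,
    prod_withDensity_left hq.ennreal_ofReal, ← withDensity_mul _ (by fun_prop) (by fun_prop)]
  congr 1
  ext z
  rw [Pi.mul_apply, ← ENNReal.ofReal_mul (hq0 _).le, mul_div_cancel₀ _ (hq0 _).ne']

variable (hlogf : Integrable (fun y => Real.log (f y)) (P.map W))
  (hlogq : Integrable (fun y => Real.log (q y)) (P.map fun ω => X ω + W ω))
include hf0 hlogf hlogq

lemma mutualInfo_add_ne_top_and_toReal_eq :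
    mutualInfo (fun ω => X ω + W ω) X P ≠ ∞ ∧
      (mutualInfo (fun ω => X ω + W ω) X P).toReal
        = ∫ y, Real.log (f y) ∂(P.map W) - ∫ y, Real.log (q y) ∂(P.map fun ω => X ω + W ω) := by
  have hY : AEMeasurable (fun ω => X ω + W ω) P := hX.add hW
  have hXP : IsProbabilityMeasure (P.map X) := Measure.isProbabilityMeasure_map hX
  have hYP : IsProbabilityMeasure (P.map fun ω => X ω + W ω) := Measure.isProbabilityMeasure_map hY
  have hJP : IsProbabilityMeasure (P.map fun ω => (X ω + W ω, X ω)) :=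
    Measure.isProbabilityMeasure_map (hY.prodMk hX)
  have hJ := map_add_prodMk_eq_withDensity_div hX hW hXW hf hq hq0 hWf hYq
  rw [hJ] at hJP
  have hr : Measurable fun z : G × G => f (z.1 - z.2) / q z.1 := by fun_prop
  have hr0 (z : G × G) : 0 ≤ f (z.1 - z.2) / q z.1 := div_nonneg (hf0 _).le (hq0 _).le
  have hlogr (ω : Ω) : Real.log (f (X ω + W ω - X ω) / q (X ω + W ω))
      = Real.log (f (W ω)) - Real.log (q (X ω + W ω)) := by
    rw [add_sub_cancel_left, Real.log_div (hf0 _).ne' (hq0 _).ne']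
  have hlogW : Integrable (fun ω => Real.log (f (W ω))) P := hlogf.comp_aemeasurable hW
  have hlogY : Integrable (fun ω => Real.log (q (X ω + W ω))) P := hlogq.comp_aemeasurable hY
  have hint : Integrable (fun z : G × G => Real.log (f (z.1 - z.2) / q z.1))
      (P.map fun ω => (X ω + W ω, X ω)) := by
    rw [integrable_map_measure hr.log.aestronglyMeasurable (hY.prodMk hX)]
    simp only [Function.comp_def, hlogr]
    exact hlogW.sub hlogY
  unfold mutualInfo
  rw [hJ] at hint ⊢
  refine ⟨klDiv_withDensity_ofReal_ne_top hr hr0 hint, ?_⟩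
  rw [toReal_klDiv_withDensity_ofReal hr hr0 (by rw [measure_univ, measure_univ]), ← hJ,
    integral_map (hY.prodMk hX) hr.log.aestronglyMeasurable]
  simp only [hlogr]
  rw [integral_sub hlogW hlogY, integral_map hW hf.log.aestronglyMeasurable,
    integral_map hY hq.log.aestronglyMeasurable]

end AdditiveNoise

section GaussianNoise

variable {N : ℕ} {d : Fin N → ℝ} (hd : ∀ i, 0 < d i) {κ : Type*} [Fintype κ] [Nonempty κ]
  {c : κ → ℝ≥0} (hc : ∀ n, 0 < c n) {v : κ → Fin N → ℝ} (hv : ∀ n i, 0 < v n i)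
  {Ω : Type*} [MeasurableSpace Ω] {P : Measure Ω} [IsProbabilityMeasure P]
include hd hc hv

lemma mutualInfo_gaussianMixture_ne_top_and_le_toReal {X W : Ω → Fin N → ℂ}
    (hX : AEMeasurable X P) (hW : HasLaw W (complexGaussianDiag d) P) (hXW : IndepFun X W P)
    (hY : P.map (fun ω => X ω + W ω) = ∑ n, c n • complexGaussianDiag (v n)) :
    mutualInfo (fun ω => X ω + W ω) X P ≠ ∞ ∧
      (-∑ i, Real.log (Real.pi * d i) - N)
          - ∑ n, c n * (Real.log (c n) + (-∑ i, Real.log (Real.pi * v n i) - N)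
            + Real.log (∑ k, ∏ i, 2 * v n i / (v n i + v k i)))
        ≤ (mutualInfo (fun ω => X ω + W ω) X P).toReal := by
  have hlogY : Integrable (fun y => Real.log (∑ n, c n * complexGaussianDiagPDFReal (v n) y))
      (∑ n, c n • complexGaussianDiag (v n)) :=
    integrable_finsetSum_measure.2 fun n _ =>
      (integrable_log_gaussianMixture hc hv (v n)).smul_measure_nnreal
  obtain ⟨hfin, hval⟩ := mutualInfo_add_ne_top_and_toReal_eq hX hW.aemeasurable hXW
    (measurable_complexGaussianDiagPDFReal d) (by fun_prop) (complexGaussianDiagPDFReal_pos hd)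
    (sum_mul_complexGaussianDiagPDFReal_pos hc hv)
    (hW.map_eq.trans (complexGaussianDiag_eq_withDensity hd))
    (hY.trans (sum_smul_complexGaussianDiag_eq_withDensity c hv))
    (hW.map_eq ▸ integrable_log_complexGaussianDiagPDFReal hd d) (hY ▸ hlogY)
  refine ⟨hfin, ?_⟩
  rw [hval, hW.map_eq, integral_log_complexGaussianDiagPDFReal hd, hY]
  exact sub_le_sub_left (integral_log_gaussianMixture_le hc hv) _

end GaussianNoise

section SpatialModulation

variable {N : ℕ}

lemma single_apply_nonneg {ι M : Type*} [DecidableEq ι] [Zero M] [Preorder M] {c : M} (hc : 0 ≤ c)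
    (n i : ι) : 0 ≤ (Pi.single n c : ι → M) i :=
  (Pi.single_nonneg.2 hc : (0 : ι → M) ≤ Pi.single n c) i

/-- The diagonal of the covariance matrix `covMatrix S n`. -/
noncomputable def covDiag (S : Fin N → ℝ) (n : Fin N) : Fin N → ℝ :=
  (fun i => 1 / S i) + Pi.single n (N : ℝ)

lemma covMatrix_eq_diagonal (S : Fin N → ℝ) (n : Fin N) :
    covMatrix S n = Matrix.diagonal (covDiag S n) := by
  rw [covMatrix, ← Matrix.diagonal_smul, Matrix.diagonal_add, covDiag, ← Pi.single_smul,
    smul_eq_mul, mul_one]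
  rfl

section Law

lemma measurable_smSymbol (n : Fin N) : Measurable (smSymbol · n) :=
  (measurable_update 0).comp (measurable_const_mul _)

lemma measurable_uncurry_smSymbol : Measurable fun z : ℂ × Fin N => smSymbol z.1 z.2 :=
  measurable_from_prod_countable_left measurable_smSymbol

lemma map_smSymbol (n : Fin N) :
    (complexGaussian 1).map (smSymbol · n) = complexGaussianDiag (Pi.single n (N : ℝ)) := by
  have heval : (complexGaussianDiag fun _ : Fin N => 1).map (Function.eval n)
      = complexGaussian 1 :=
    (measurePreserving_eval (fun _ : Fin N => complexGaussian 1) n).map_eq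
  have hscale : (fun y : Fin N → ℂ => smSymbol (y n) n)
      = fun y i => ((√((Pi.single n (N : ℝ) : Fin N → ℝ) i) : ℝ) : ℂ) * y i := by
    ext y i
    obtain rfl | hi := eq_or_ne i n
    · simp [smSymbol]
    · simp [smSymbol, hi]
  calc (complexGaussian 1).map (smSymbol · n)
      = (complexGaussianDiag fun _ : Fin N => 1).map fun y => smSymbol (y n) n := by
        rw [← heval, Measure.map_map (measurable_smSymbol n) (measurable_pi_apply n)]
        rfl
    _ = complexGaussianDiag (Pi.single n (N : ℝ)) := by
        rw [hscale, complexGaussianDiag, Measure.pi_map_pi fun i => by fun_prop]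
        simp only [complexGaussian_map_mul zero_le_one,
          Real.sq_sqrt (single_apply_nonneg N.cast_nonneg _ _), mul_one]
        rfl

variable {Ω : Type*} [MeasurableSpace Ω] {P : Measure Ω} [IsProbabilityMeasure P]
  {s : Ω → ℂ} {a : Ω → Fin N} {w : Ω → Fin N → ℂ}

lemma map_smSymbol_add {d : Fin N → ℝ} (hd : ∀ i, 0 ≤ d i) (hs : HasLaw s (complexGaussian 1) P)
    (ha : AEMeasurable a P) (hw : HasLaw w (complexGaussianDiag d) P) (hsa : IndepFun s a P)
    (hsaw : IndepFun (fun ω => (s ω, a ω)) w P) :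
    P.map (fun ω => smSymbol (s ω) (a ω) + w ω)
      = ∑ n, P {ω | a ω = n} • complexGaussianDiag (d + Pi.single n (N : ℝ)) := by
  calc P.map (fun ω => smSymbol (s ω) (a ω) + w ω)
      = P.map (fun ω => smSymbol (s ω) (a ω)) ∗ P.map w :=
        (hsaw.comp measurable_uncurry_smSymbol measurable_id).map_add_eq_map_conv_map₀
          (measurable_uncurry_smSymbol.comp_aemeasurable (hs.aemeasurable.prodMk ha))
          hw.aemeasurable
    _ = (∑ n, P {ω | a ω = n} • complexGaussianDiag (Pi.single n (N : ℝ)))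
          ∗ complexGaussianDiag d := by
        rw [map_eq_sum_smul_map_of_indepFun hs.aemeasurable ha hsa measurable_smSymbol,
          hs.map_eq, hw.map_eq]
        simp only [map_smSymbol]
        rfl
    _ = ∑ n, P {ω | a ω = n} • complexGaussianDiag (d + Pi.single n (N : ℝ)) := by
        simp only [sum_smul_conv,
          complexGaussianDiag_conv (single_apply_nonneg N.cast_nonneg _) hd, add_comm]

end Law

variable {S : Fin N → ℝ} (hS : ∀ i, 0 < S i)
include hS

lemma covDiag_pos (n i : Fin N) : 0 < covDiag S n i :=
  add_pos_of_pos_of_nonneg (one_div_pos.2 (hS i)) (single_apply_nonneg N.cast_nonneg n i)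

lemma det_covMatrix_div_pos (n k : Fin N) :
    0 < (covMatrix S n).det / (covMatrix S n + covMatrix S k).det := by
  simp only [covMatrix_eq_diagonal, Matrix.diagonal_add, Matrix.det_diagonal]
  exact div_pos (Finset.prod_pos fun i _ => covDiag_pos hS n i)
    (Finset.prod_pos fun i _ => add_pos (covDiag_pos hS n i) (covDiag_pos hS k i))

lemma log_sum_prod_covDiag (n : Fin N) :
    Real.log (∑ k, ∏ i, 2 * covDiag S n i / (covDiag S n i + covDiag S k i))
      = N * Real.log 2
        + Real.log (∑ k, (covMatrix S n).det / (covMatrix S n + covMatrix S k).det) := by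
  have hpos : 0 < ∑ k, (covMatrix S n).det / (covMatrix S n + covMatrix S k).det :=
    Finset.sum_pos (fun k _ => det_covMatrix_div_pos hS n k) ⟨n, Finset.mem_univ n⟩
  have hprod (k : Fin N) : ∏ i, 2 * covDiag S n i / (covDiag S n i + covDiag S k i)
      = 2 ^ N * ((covMatrix S n).det / (covMatrix S n + covMatrix S k).det) := by
    simp only [covMatrix_eq_diagonal, Matrix.diagonal_add, Matrix.det_diagonal,
      Finset.prod_div_distrib, Finset.prod_mul_distrib, Finset.prod_const, Finset.card_univ,
      Fintype.card_fin, mul_div_assoc]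
  simp only [hprod, ← Finset.mul_sum]
  rw [Real.log_mul (by positivity) hpos.ne', Real.log_pow]

lemma sum_log_pi_mul_covDiag (n : Fin N) :
    ∑ i, Real.log (Real.pi * covDiag S n i)
      = ∑ i, Real.log (Real.pi * (1 / S i)) + Real.log (1 + N * S n) := by
  have hfactor (i : Fin N) : Real.log (Real.pi * covDiag S n i)
      = Real.log (Real.pi * (1 / S i)) + if i = n then Real.log (1 + N * S n) else 0 := by
    have hSi := hS i
    split_ifs with hi
    · subst hi
      rw [← Real.log_mul (by positivity) (by positivity)]
      simp only [covDiag, Pi.add_apply, Pi.single_eq_same]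
      field_simp
    · simp [covDiag, hi]
  simp [hfactor, Finset.sum_add_distrib]

lemma seBound_mul_log_two (hN : N ≠ 0) :
    seBound S * Real.log 2 = (-∑ i, Real.log (Real.pi * (1 / S i)) - N)
      - ∑ n, (N : ℝ)⁻¹ * (Real.log (N : ℝ)⁻¹ + (-∑ i, Real.log (Real.pi * covDiag S n i) - N)
        + Real.log (∑ k, ∏ i, 2 * covDiag S n i / (covDiag S n i + covDiag S k i))) := by
  have hlog : Real.log 2 ≠ 0 := (Real.log_pos one_lt_two).ne'
  simp only [log_sum_prod_covDiag hS, sum_log_pi_mul_covDiag hS, seBound, Real.logb, Real.log_inv,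
    ← Finset.mul_sum, ← Finset.sum_div, Finset.sum_add_distrib, Finset.sum_sub_distrib,
    Finset.sum_neg_distrib, Finset.sum_const, Finset.card_univ, Fintype.card_fin, nsmul_eq_mul]
  field_simp
  ring

end SpatialModulation

section Sinr

lemma norm_integral_sq_le {α E : Type*} [MeasurableSpace α] {μ : Measure α}
    [IsProbabilityMeasure μ] [NormedAddCommGroup E] [NormedSpace ℝ E] {f : α → E}
    (hf : MemLp f 2 μ) : ‖∫ x, f x ∂μ‖ ^ 2 ≤ ∫ x, ‖f x‖ ^ 2 ∂μ := by
  have hvar := variance_nonneg (fun x => ‖f x‖) μ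
  rw [variance_eq_sub hf.norm] at hvar
  calc ‖∫ x, f x ∂μ‖ ^ 2 ≤ (∫ x, ‖f x‖ ∂μ) ^ 2 :=
        pow_le_pow_left₀ (norm_nonneg _) (norm_integral_le_integral_norm _) 2
    _ ≤ ∫ x, ‖f x‖ ^ 2 ∂μ := sub_nonneg.1 hvar

variable {Nt Nr : ℕ}

instance isProbabilityMeasure_rayleigh : IsProbabilityMeasure (rayleigh Nt Nr) := by
  unfold rayleigh; infer_instance

variable {g : Fin Nt → Channel Nt Nr → Fin Nr → ℂ} {n : Fin Nt}
  (hgain : MemLp (gain g n n) 2 (rayleigh Nt Nr))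
include hgain

lemma norm_integral_gain_sq_le_sum {ρ : ℝ} (hρ : 0 ≤ ρ) :
    ρ / Nt * ‖∫ H, gain g n n H ∂(rayleigh Nt Nr)‖ ^ 2
      ≤ ∑ k, ρ / Nt * ∫ H, ‖gain g n k H‖ ^ 2 ∂(rayleigh Nt Nr) :=
  calc ρ / Nt * ‖∫ H, gain g n n H ∂(rayleigh Nt Nr)‖ ^ 2
      ≤ ρ / Nt * ∫ H, ‖gain g n n H‖ ^ 2 ∂(rayleigh Nt Nr) :=
        mul_le_mul_of_nonneg_left (norm_integral_sq_le hgain) (by positivity)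
    _ ≤ ∑ k, ρ / Nt * ∫ H, ‖gain g n k H‖ ^ 2 ∂(rayleigh Nt Nr) :=
        Finset.single_le_sum (f := fun k => ρ / Nt * ∫ H, ‖gain g n k H‖ ^ 2 ∂(rayleigh Nt Nr))
          (fun k _ => by positivity) (Finset.mem_univ n)

lemma sinr_pos {ρml ρfl σsq : ℝ} (hρml : 0 < ρml) (hρfl : 0 < ρfl) (hσ : 0 ≤ σsq)
    (hmean : ∫ H, gain g n n H ∂(rayleigh Nt Nr) ≠ 0) : 0 < sinr ρml ρfl σsq g n := by
  have hNt : (0 : ℝ) < Nt := Nat.cast_pos.2 n.pos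
  have hml := norm_integral_gain_sq_le_sum hgain hρml.le
  have hfl := (by positivity : 0 < ρfl / Nt * ‖∫ H, gain g n n H ∂(rayleigh Nt Nr)‖ ^ 2).trans_le
    (norm_integral_gain_sq_le_sum hgain hρfl.le)
  have hnoise : 0 ≤ σsq * ∫ H, ∑ r, ‖g n H r‖ ^ 2 ∂(rayleigh Nt Nr) := by positivity
  exact div_pos (by positivity) (by linarith)

end Sinr

end SMLDM

open SMLDM in
theorem theorem1_general {N : ℕ} {S : Fin N → ℝ} (hS : ∀ n, 0 < S n)
    {Ω : Type*} [MeasurableSpace Ω] (P : Measure Ω) [IsProbabilityMeasure P]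
    (s : Ω → ℂ) (a : Ω → Fin N) (w : Ω → Fin N → ℂ) (hs : HasLaw s (complexGaussian 1) P)
    (ha : AEMeasurable a P) (ha_unif : ∀ n, P {ω | a ω = n} = (N : ℝ≥0∞)⁻¹)
    (hw : HasLaw w (complexGaussianDiag fun n => 1 / S n) P)
    (hsa : IndepFun s a P) (hsaw : IndepFun (fun ω => (s ω, a ω)) w P) :
    mutualInfo (fun ω => smSymbol (s ω) (a ω) + w ω) (fun ω => smSymbol (s ω) (a ω)) P ≠ ∞ ∧
      seBound S ≤ (mutualInfo (fun ω => smSymbol (s ω) (a ω) + w ω)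
        (fun ω => smSymbol (s ω) (a ω)) P).toReal / Real.log 2 := by
  have hNonempty : Nonempty (Fin N) := P.nonempty_of_neZero.map a
  have hN : N ≠ 0 := (Fin.pos_iff_nonempty.2 hNonempty).ne'
  have hd (i : Fin N) : 0 < 1 / S i := one_div_pos.2 (hS i)
  have hY : P.map (fun ω => smSymbol (s ω) (a ω) + w ω)
      = ∑ n, (N : ℝ≥0)⁻¹ • complexGaussianDiag (covDiag S n) := by
    rw [map_smSymbol_add (fun i => (hd i).le) hs ha hw hsa hsaw]
    simp only [ha_unif, covDiag, ENNReal.smul_def, ENNReal.coe_inv (Nat.cast_ne_zero.2 hN),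
      ENNReal.coe_natCast]
  have hX : AEMeasurable (fun ω => smSymbol (s ω) (a ω)) P :=
    measurable_uncurry_smSymbol.comp_aemeasurable (hs.aemeasurable.prodMk ha)
  have hXw : IndepFun (fun ω => smSymbol (s ω) (a ω)) w P :=
    hsaw.comp measurable_uncurry_smSymbol measurable_id
  obtain ⟨hfin, hle⟩ := mutualInfo_gaussianMixture_ne_top_and_le_toReal hd
    (fun _ => by positivity) (covDiag_pos hS) hX hw hXw hY
  refine ⟨hfin, (le_div_iff₀ (Real.log_pos one_lt_two)).2 ?_⟩
  rw [seBound_mul_log_two hS hN]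
  simpa only [NNReal.coe_inv, NNReal.coe_natCast] using hle

theorem theorem1
    {Nt Nr : ℕ} (hNt : 0 < Nt)
    -- transmit powers of the mobile and of the fixed layer, noise variance of the mobile layer
    (ρml ρfl σsq : ℝ) (hρfl : 0 < ρfl) (hρml : ρfl < ρml) (hσ : 0 < σsq)
    -- combining vectors, with finite second moments and non-vanishing mean useful gains
    (g : Fin Nt → SMLDM.Channel Nt Nr → Fin Nr → ℂ)
    (hg : ∀ n r, MemLp (fun H => g n H r) 2 (SMLDM.rayleigh Nt Nr))
    (hgain : ∀ n k, MemLp (SMLDM.gain g n k) 2 (SMLDM.rayleigh Nt Nr))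
    (hmean : ∀ n, ∫ H, SMLDM.gain g n n H ∂(SMLDM.rayleigh Nt Nr) ≠ 0)
    -- constellation symbol, active antenna and noise of the equivalent channel
    {Ω : Type*} [MeasurableSpace Ω] (P : Measure Ω) [IsProbabilityMeasure P]
    (s : Ω → ℂ) (a : Ω → Fin Nt) (w : Ω → Fin Nt → ℂ)
    (hs : HasLaw s (SMLDM.complexGaussian 1) P)
    (ha : AEMeasurable a P) (ha_unif : ∀ n, P {ω | a ω = n} = (Nt : ℝ≥0∞)⁻¹)
    (hw : HasLaw w
      (SMLDM.complexGaussianDiag (fun n => 1 / SMLDM.sinr ρml ρfl σsq g n)) P)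
    (hsa : IndepFun s a P) (hsaw : IndepFun (fun ω => (s ω, a ω)) w P) :
    SMLDM.mutualInfo (fun ω => SMLDM.smSymbol (s ω) (a ω) + w ω)
        (fun ω => SMLDM.smSymbol (s ω) (a ω)) P ≠ ∞ ∧
      SMLDM.seBound (SMLDM.sinr ρml ρfl σsq g) ≤
        (SMLDM.mutualInfo (fun ω => SMLDM.smSymbol (s ω) (a ω) + w ω)
          (fun ω => SMLDM.smSymbol (s ω) (a ω)) P).toReal / Real.log 2 :=
  theorem1_general (fun n => SMLDM.sinr_pos (hgain n n) (hρfl.trans hρml) hρfl hσ.le (hmean n))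
    P s a w hs ha ha_unif hw hsa hsaw
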